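/- Let $d\ge 1$ be an integer and $p>1$. There is a constant $C(d,p)>0$, depending only on $d$ and $p$, such that the following holds for every $s\in(0,1)$ with $sp<d$. Put $$\mathcal C:=C(d,p)\,\frac{s(1-s)}{(d-sp)^{p-1}},\qquad [u]_{W^{s,p}(\mathbb R^d)}^p:=\int_{\mathbb R^d}\int_{\mathbb R^d}\frac{|u(x)-u(y)|^p}{|x-y|^{d+sp}}\,dx\,dy,$$ and let $W^{s,p}(\mathbb R^d)$ be the completion of the compactly supported smooth (real- or complex-valued) functions on $\mathbb R^d$ under the norm $(\|u\|_{L^p(\mathbb R^d)}^p+[u]_{W^{s,p}(\mathbb R^d)}^p)^{1/p}$, regarded as a subspace of $L^p(\mathbb R^d)$. Then for every $u\in W^{s,p}(\mathbb R^d)$ and every real $c>0$, $$\int_{\mathbb R^d}|u(x)|^p\log\left(\frac{|u(x)|^p}{\|u\|_{L^p(\mathbb R^d)}^p}\right)dx+\frac ds(1+\log c)\,\|u\|_{L^p(\mathbb R^d)}^p\le\frac{d\,e^{p-1}c^p\,\mathcal C}{sp}\,[u]_{W^{s,p}(\mathbb R^d)}^p .$$ Here the integrand on the left is taken to be $0$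 where $u(x)=0$. The positive part of this integrand has finite integral, so the integral on the left is well defined in $[-\infty,\infty)$; if it equals $-\infty$, the inequality holds trivially. -/

import Mathlib

open MeasureTheory
open scoped ENNReal ContDiff

noncomputable section

/-- The `p`-th power of the Gagliardo seminorm of `u : ℝᵈ → 𝕜`, that is
`∫∫ |u(x) - u(y)|^p / |x - y|^(d + s p) dx dy`, as an element of `[0, ∞]`. -/
def gagliardoEnergy {d : ℕ} {𝕜 : Type*} [RCLike 𝕜] (s p : ℝ)
    (u : EuclideanSpace ℝ (Fin d) → 𝕜) : ℝ≥0∞ :=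
  ∫⁻ y, ∫⁻ x, ENNReal.ofReal (‖u x - u y‖ ^ p / ‖x - y‖ ^ ((d : ℝ) + s * p))

/-- The norm `(‖u‖_p^p + [u]_{s,p}^p)^(1/p)`, as an element of `[0, ∞]`. -/
def fracSobolevNorm {d : ℕ} {𝕜 : Type*} [RCLike 𝕜] (s p : ℝ)
    (u : EuclideanSpace ℝ (Fin d) → 𝕜) : ℝ≥0∞ :=
  (eLpNorm u (ENNReal.ofReal p) volume ^ p + gagliardoEnergy s p u) ^ (1 / p)

/-- Membership of `u` in the fractional Sobolev space `W^{s,p}(ℝᵈ)`, the completion of the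
compactly supported smooth functions under `fracSobolevNorm`. The completion is realized inside
`L^p` as the closure of the compactly supported smooth functions in the (complete) normed space of
all `u ∈ L^p` with finite Gagliardo seminorm. -/
structure MemFracSobolev {d : ℕ} {𝕜 : Type*} [RCLike 𝕜] (s p : ℝ)
    (u : EuclideanSpace ℝ (Fin d) → 𝕜) : Prop where
  memLp : MemLp u (ENNReal.ofReal p) volume
  energy_lt_top : gagliardoEnergy s p u < ⊤
  approx : ∀ ε : ℝ≥0∞, 0 < ε → ∃ φ : EuclideanSpace ℝ (Fin d) → 𝕜,
    ContDiff ℝ ∞ φ ∧ HasCompactSupport φ ∧ fracSobolevNorm s p (u - φ) < ε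

/-- The integral over `ℝᵈ` of a real function whose positive part has finite integral, with value
in `[-∞, ∞)`: the integral of the positive part minus that of the negative part. It is `-∞` when
the negative part has infinite integral, and the usual integral when `f` is integrable. -/
def extIntegral {d : ℕ} (f : EuclideanSpace ℝ (Fin d) → ℝ) : EReal :=
  ((∫⁻ x, ENNReal.ofReal (f x) : ℝ≥0∞) : EReal) - ((∫⁻ x, ENNReal.ofReal (-f x) : ℝ≥0∞) : EReal)

/-- The integrand `|u(x)|^p log (|u(x)|^p / ‖u‖_p^p)`; it is `0` where `u(x) = 0`. -/
def entropyIntegrand {d : ℕ} {𝕜 : Type*} [RCLike 𝕜] (p : ℝ)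
    (u : EuclideanSpace ℝ (Fin d) → 𝕜) (x : EuclideanSpace ℝ (Fin d)) : ℝ :=
  ‖u x‖ ^ p * Real.log (‖u x‖ ^ p / ∫ y, ‖u y‖ ^ p)

end

/-! Write `N = ∫ |u|^p`, `I(h) = ∫ |u(x + h) - u(x)|^p dx` and `b = s p / d`. Everything rests on
the weak-type bound `∫_{|u|^p > τ N} |u|^p ≤ K s (1 - s) τ^(-b) [u]^p` for all `τ > 0`
(`setLIntegral_lt_enorm_rpow_le`), with `K` independent of `s`.

Where `|u|^p > τ N`, the average of `|u|^p` over a ball of radius `r ≥ R`, with `τ |B_R| = 2^p`, is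
too small to account for `|u(x)|^p`, so the increments must: `|B_r| M ≤ 2^p ∫_{B_r} I`, where `M` is
the mass to be bounded. For `t < R`, `I(n h) ≤ n^p I(h)` carries this down to `B_t` at the price of
a factor `(t / R)^p`. Integrating over `t` against `t^(-d - s p - 1)` rebuilds the Gagliardo energy
on the right; on the left the two ranges of `t` contribute `1 / (p - s p) + 1 / (s p) = 1 / (s (1 -
s) p)`, the source of the factor `s (1 - s)`.

Integrating the weak-type bound in `dt / t` over `t > a` bounds `∫ |u|^p log⁺(|u|^p / (N a))` by a
multiple of `a^(-b) / b` (`lintegral_mul_log_le_of_weakType`). The choice `a = (e c)^(-d / s)` gives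
the theorem. The resulting constant does not blow up as `s p → d`, so the factor `(d - s p)^(1 - p)`
costs only `d^(p - 1)` in `C`. -/

/-! ### Increments in `L^p` and the absorption argument -/

section TranslationEnergy

variable {E F : Type*} [NormedAddCommGroup E] [MeasurableSpace E] [BorelSpace E]
  [NormedAddCommGroup F]

/-- The `p`-th power of the `L^p` norm of the increment `u (· + h) - u`. -/
noncomputable def translationEnergy (μ : Measure E) (p : ℝ) (u : E → F) (h : E) : ℝ≥0∞ :=
  ∫⁻ x, ‖u (x + h) - u x‖ₑ ^ p ∂μ

theorem measurable_enorm_translate_sub [SecondCountableTopology E] {u : E → F}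
    (hu : StronglyMeasurable u) (p : ℝ) :
    Measurable fun z : E × E => ‖u (z.2 + z.1) - u z.2‖ₑ ^ p :=
  ((((hu.comp_measurable (measurable_snd.add measurable_fst)).sub
    (hu.comp_measurable measurable_snd)).enorm)).pow_const p

theorem measurable_translationEnergy [SecondCountableTopology E] {μ : Measure E} [SFinite μ]
    {u : E → F} (hu : StronglyMeasurable u) (p : ℝ) :
    Measurable (translationEnergy μ p u) :=
  (measurable_enorm_translate_sub hu p).lintegral_prod_right'

/-- Telescope the increment into `n` steps of size `h`, use convexity of the `p`-th power, and note
that translation invariance makes all the steps contribute equally. -/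
theorem translationEnergy_nsmul_le [SecondCountableTopology E] {μ : Measure E}
    [μ.IsAddRightInvariant] {u : E → F} (hu : StronglyMeasurable u) {p : ℝ} (hp : 1 ≤ p)
    (n : ℕ) (h : E) :
    translationEnergy μ p u (n • h) ≤ (n : ℝ≥0∞) ^ p * translationEnergy μ p u h := by
  have hshift (i : ℕ) :
      ∫⁻ x, ‖u (x + (i + 1) • h) - u (x + i • h)‖ₑ ^ p ∂μ = translationEnergy μ p u h := by
    rw [translationEnergy,
      ← lintegral_add_right_eq_self (fun x => ‖u (x + h) - u x‖ₑ ^ p) (i • h)]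
    simp only [add_smul, one_smul, add_assoc]
  have hpt (x : E) : ‖u (x + n • h) - u x‖ₑ ^ p
      ≤ (n : ℝ≥0∞) ^ (p - 1) *
        ∑ i ∈ Finset.range n, ‖u (x + (i + 1) • h) - u (x + i • h)‖ₑ ^ p := by
    have h1 : u (x + n • h) - u x
        = ∑ i ∈ Finset.range n, (u (x + (i + 1) • h) - u (x + i • h)) := by
      rw [Finset.sum_range_sub (fun i => u (x + i • h))]; simp
    calc ‖u (x + n • h) - u x‖ₑ ^ p
        ≤ (∑ i ∈ Finset.range n, ‖u (x + (i + 1) • h) - u (x + i • h)‖ₑ) ^ p := by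
          rw [h1]; gcongr; exact enorm_sum_le _ _
      _ ≤ _ := by
          simpa using ENNReal.rpow_sum_le_const_mul_sum_rpow (Finset.range n)
            (fun i => ‖u (x + (i + 1) • h) - u (x + i • h)‖ₑ) hp
  have hmeas (i : ℕ) : Measurable fun x => ‖u (x + (i + 1) • h) - u (x + i • h)‖ₑ ^ p :=
    (((hu.comp_measurable (measurable_id.add_const _)).sub
      (hu.comp_measurable (measurable_id.add_const _))).enorm).pow_const p
  calc translationEnergy μ p u (n • h)
      ≤ ∫⁻ x, (n : ℝ≥0∞) ^ (p - 1) *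
        ∑ i ∈ Finset.range n, ‖u (x + (i + 1) • h) - u (x + i • h)‖ₑ ^ p ∂μ :=
        lintegral_mono hpt
    _ = (n : ℝ≥0∞) ^ (p - 1) * (n * translationEnergy μ p u h) := by
        rw [lintegral_const_mul _ (Finset.measurable_sum _ fun i _ => hmeas i),
          lintegral_finsetSum _ fun i _ => hmeas i]
        simp [hshift]
    _ = (n : ℝ≥0∞) ^ p * translationEnergy μ p u h := by
        rcases Nat.eq_zero_or_pos n with rfl | hn
        · simp [ENNReal.zero_rpow_of_pos (zero_lt_one.trans_le hp)]
        · rw [← mul_assoc]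
          congr 1
          nth_rewrite 2 [← ENNReal.rpow_one (n : ℝ≥0∞)]
          rw [← ENNReal.rpow_add _ _ (by positivity) (by simp)]
          simp

/-- If the ball of radius `r` has measure at least `2 ^ p / τ`, then the part of `∫ ‖u‖ ^ p` carried
by the set where `‖u‖ ^ p` exceeds `τ ∫ ‖u‖ ^ p` is controlled by the increments of size at most
`r`. -/
theorem measure_ball_mul_setLIntegral_le [SecondCountableTopology E] {μ : Measure E} [SFinite μ]
    [μ.IsAddLeftInvariant] {u : E → F} (hu : StronglyMeasurable u) {p : ℝ} (hp : 1 ≤ p)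
    {τ : ℝ≥0∞} {r : ℝ} (hB : μ (Metric.ball 0 r) ≠ ⊤)
    (hr : 2 ^ p ≤ τ * μ (Metric.ball 0 r)) :
    μ (Metric.ball 0 r) * ∫⁻ x in {x | τ * ∫⁻ y, ‖u y‖ₑ ^ p ∂μ < ‖u x‖ₑ ^ p}, ‖u x‖ₑ ^ p ∂μ
      ≤ 2 ^ p * ∫⁻ h in Metric.ball 0 r, translationEnergy μ p u h ∂μ := by
  set N := ∫⁻ y, ‖u y‖ₑ ^ p ∂μ
  set B : Set E := Metric.ball 0 r
  have hmeas := measurable_enorm_translate_sub hu p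
  have hmf : Measurable fun x => ‖u x‖ₑ ^ p := hu.enorm.pow_const p
  have hS : MeasurableSet {x | τ * N < ‖u x‖ₑ ^ p} := measurableSet_lt measurable_const hmf
  have hp0 : 0 < p := zero_lt_one.trans_le hp
  have h2 : (2 : ℝ≥0∞) ^ p = 2 ^ (p - 1) * 2 := by
    nth_rewrite 3 [← ENNReal.rpow_one (2 : ℝ≥0∞)]
    rw [← ENNReal.rpow_add _ _ (by simp) (by simp)]
    simp
  have hpt (x : E) (hx : τ * N < ‖u x‖ₑ ^ p) : μ B * ‖u x‖ₑ ^ p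
      ≤ 2 ^ p * ∫⁻ h in B, ‖u (x + h) - u x‖ₑ ^ p ∂μ := by
    set J := ∫⁻ h in B, ‖u (x + h) - u x‖ₑ ^ p ∂μ
    have htri (h : E) : ‖u x‖ₑ ^ p
        ≤ 2 ^ (p - 1) * (‖u (x + h) - u x‖ₑ ^ p + ‖u (x + h)‖ₑ ^ p) := by
      refine le_trans ?_ (ENNReal.rpow_add_le_mul_rpow_add_rpow _ _ hp)
      gcongr
      calc ‖u x‖ₑ = ‖u (x + h) - (u (x + h) - u x)‖ₑ := by simp
        _ ≤ _ := (enorm_sub_le).trans (by rw [add_comm])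
    have h1 : μ B * ‖u x‖ₑ ^ p ≤ 2 ^ (p - 1) * (J + N) := by
      calc μ B * ‖u x‖ₑ ^ p = ∫⁻ _ in B, ‖u x‖ₑ ^ p ∂μ := by simp [mul_comm]
        _ ≤ ∫⁻ h in B, 2 ^ (p - 1) * (‖u (x + h) - u x‖ₑ ^ p + ‖u (x + h)‖ₑ ^ p) ∂μ :=
          lintegral_mono htri
        _ = 2 ^ (p - 1) * (J + ∫⁻ h in B, ‖u (x + h)‖ₑ ^ p ∂μ) := by
          rw [lintegral_const_mul' _ _ (by simp), lintegral_add_right]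
          exact hmf.comp (measurable_const_add x)
        _ ≤ 2 ^ (p - 1) * (J + N) := by
          gcongr
          refine (setLIntegral_le_lintegral _ _).trans_eq ?_
          exact lintegral_add_left_eq_self (fun y => ‖u y‖ₑ ^ p) x
    -- The size of the ball and the level `τ` together make the `N` term at most half of the left
    -- side once `h1` is doubled.
    have h3 : 2 ^ p * N ≤ μ B * ‖u x‖ₑ ^ p := by
      calc 2 ^ p * N ≤ τ * μ B * N := by gcongr
        _ = μ B * (τ * N) := by ring
        _ ≤ _ := by gcongr
    have hfin : μ B * ‖u x‖ₑ ^ p ≠ ⊤ :=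
      ENNReal.mul_ne_top hB (ENNReal.rpow_ne_top_of_nonneg hp0.le enorm_ne_top)
    -- Absorption: `h1` is added to itself, and one copy of the finite left side is then cancelled.
    have h4 : μ B * ‖u x‖ₑ ^ p + μ B * ‖u x‖ₑ ^ p ≤ 2 ^ p * J + μ B * ‖u x‖ₑ ^ p :=
      calc μ B * ‖u x‖ₑ ^ p + μ B * ‖u x‖ₑ ^ p
          ≤ 2 ^ (p - 1) * (J + N) + 2 ^ (p - 1) * (J + N) := add_le_add h1 h1
        _ = 2 ^ p * J + 2 ^ p * N := by rw [h2]; ring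
        _ ≤ _ := by gcongr
    exact (ENNReal.add_le_add_iff_right hfin).1 h4
  calc μ B * ∫⁻ x in {x | τ * N < ‖u x‖ₑ ^ p}, ‖u x‖ₑ ^ p ∂μ
      = ∫⁻ x in {x | τ * N < ‖u x‖ₑ ^ p}, μ B * ‖u x‖ₑ ^ p ∂μ :=
        (lintegral_const_mul _ hmf).symm
    _ ≤ ∫⁻ x in {x | τ * N < ‖u x‖ₑ ^ p}, 2 ^ p * ∫⁻ h in B, ‖u (x + h) - u x‖ₑ ^ p ∂μ ∂μ :=
        setLIntegral_mono' hS hpt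
    _ ≤ ∫⁻ x, 2 ^ p * ∫⁻ h in B, ‖u (x + h) - u x‖ₑ ^ p ∂μ ∂μ := setLIntegral_le_lintegral _ _
    _ = 2 ^ p * ∫⁻ x, ∫⁻ h in B, ‖u (x + h) - u x‖ₑ ^ p ∂μ ∂μ :=
        lintegral_const_mul' _ _ (by simp)
    _ = 2 ^ p * ∫⁻ h in B, translationEnergy μ p u h ∂μ := by
        rw [lintegral_lintegral_swap]
        · rfl
        · exact (hmeas.comp measurable_swap).aemeasurable

end TranslationEnergy

/-! ### Integrals of powers on half-lines and intervals -/

section PowerIntegrals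

open Set

theorem lintegral_Ioi_rpow_neg {a b : ℝ} (ha : 0 < a) (hb : 0 < b) :
    ∫⁻ t in Ioi a, ENNReal.ofReal (t ^ (-b - 1)) = ENNReal.ofReal (a ^ (-b) / b) := by
  rw [← ofReal_integral_eq_lintegral_ofReal (integrableOn_Ioi_rpow_of_lt (by linarith) ha),
    integral_Ioi_rpow_of_lt (by linarith) ha]
  · congr 1
    rw [sub_add_cancel, neg_div_neg_eq]
  · refine (ae_restrict_mem measurableSet_Ioi).mono fun t ht => ?_
    exact Real.rpow_nonneg (ha.trans ht).le _

theorem lintegral_Ioc_zero_rpow {a b : ℝ} (ha : 0 < a) (hb : 0 < b) :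
    ∫⁻ t in Ioc 0 a, ENNReal.ofReal (t ^ (b - 1)) = ENNReal.ofReal (a ^ b / b) := by
  have hint := intervalIntegral.intervalIntegrable_rpow' (a := 0) (b := a)
    (show -1 < b - 1 by linarith)
  rw [← ofReal_integral_eq_lintegral_ofReal
      ((intervalIntegrable_iff_integrableOn_Ioc_of_le ha.le).1 hint),
    ← intervalIntegral.integral_of_le ha.le, integral_rpow (Or.inl (by linarith))]
  · congr 1
    rw [sub_add_cancel, Real.zero_rpow hb.ne', sub_zero]
  · refine (ae_restrict_mem measurableSet_Ioc).mono fun t ht => ?_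
    exact Real.rpow_nonneg ht.1.le _

end PowerIntegrals

/-! ### The Gagliardo energy as an integral over balls -/

section LayerCake

open Set

variable {E F : Type*} [NormedAddCommGroup E] [MeasurableSpace E] [BorelSpace E]
  [NormedAddCommGroup F]

/-- Tonelli together with `q ∫_{t > ‖h‖} t^(-q - 1) dt = ‖h‖^(-q)`. At `h = 0` the integral in `t`
diverges while the real inverse `(0 ^ q)⁻¹` is `0`, hence the condition `g 0 = 0`. -/
theorem lintegral_Ioi_mul_setLIntegral_ball {μ : Measure E} [SFinite μ] {g : E → ℝ≥0∞}
    (hg : Measurable g) (hg0 : g 0 = 0) {q : ℝ} (hq : 0 < q) :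
    ENNReal.ofReal q *
        ∫⁻ t in Ioi (0 : ℝ), ENNReal.ofReal (t ^ (-q - 1)) * ∫⁻ h in Metric.ball 0 t, g h ∂μ
      = ∫⁻ h, g h * ENNReal.ofReal (‖h‖ ^ q)⁻¹ ∂μ := by
  have hrpow : Measurable fun t : ℝ => ENNReal.ofReal (t ^ (-q - 1)) := by fun_prop
  have hset : MeasurableSet {z : ℝ × E | ‖z.2‖ < z.1} :=
    measurableSet_lt measurable_snd.norm measurable_fst
  have hk : Measurable fun z : ℝ × E =>
      ENNReal.ofReal (z.1 ^ (-q - 1)) * {z : ℝ × E | ‖z.2‖ < z.1}.indicator (fun z => g z.2) z :=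
    (hrpow.comp measurable_fst).mul ((hg.comp measurable_snd).indicator hset)
  have hinner (t : ℝ) : ENNReal.ofReal (t ^ (-q - 1)) * ∫⁻ h in Metric.ball 0 t, g h ∂μ
      = ∫⁻ h, ENNReal.ofReal (t ^ (-q - 1)) *
          {z : ℝ × E | ‖z.2‖ < z.1}.indicator (fun z => g z.2) (t, h) ∂μ := by
    rw [lintegral_const_mul' _ _ ENNReal.ofReal_ne_top, ← lintegral_indicator measurableSet_ball]
    congr! 3 with h
    simp [indicator]
  simp_rw [hinner]
  rw [lintegral_lintegral_swap hk.aemeasurable, ← lintegral_const_mul' _ _ ENNReal.ofReal_ne_top]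
  refine lintegral_congr fun h => ?_
  rcases eq_or_ne h 0 with rfl | hh
  · simp [indicator, hg0]
  have hpos : 0 < ‖h‖ := norm_pos_iff.2 hh
  have h1 : ∫⁻ t in Ioi (0 : ℝ), ENNReal.ofReal (t ^ (-q - 1)) *
        {z : ℝ × E | ‖z.2‖ < z.1}.indicator (fun z => g z.2) (t, h)
      = ∫⁻ t in Ioi ‖h‖, ENNReal.ofReal (t ^ (-q - 1)) * g h := by
    rw [← lintegral_indicator measurableSet_Ioi, ← lintegral_indicator measurableSet_Ioi]
    refine lintegral_congr fun t => ?_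
    by_cases ht : ‖h‖ < t
    · simp [indicator, ht, hpos.trans ht]
    · simp [indicator, ht]
  rw [h1, lintegral_mul_const _ hrpow, lintegral_Ioi_rpow_neg hpos hq, ← mul_assoc,
    ← ENNReal.ofReal_mul hq.le, mul_comm, mul_div_cancel₀ _ hq.ne', Real.rpow_neg hpos.le]

theorem lintegral_lintegral_sub_eq [SecondCountableTopology E] {μ : Measure E} [SFinite μ]
    [μ.IsAddLeftInvariant] {u : E → F} (hu : StronglyMeasurable u) {p : ℝ} (hp : 0 ≤ p) (q : ℝ) :
    ∫⁻ y, ∫⁻ x, ENNReal.ofReal (‖u x - u y‖ ^ p / ‖x - y‖ ^ q) ∂μ ∂μ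
      = ∫⁻ h, translationEnergy μ p u h * ENNReal.ofReal (‖h‖ ^ q)⁻¹ ∂μ := by
  have hmeas := measurable_enorm_translate_sub hu p
  have hw : Measurable fun h : E => ENNReal.ofReal (‖h‖ ^ q)⁻¹ := by fun_prop
  have h1 (y : E) : ∫⁻ x, ENNReal.ofReal (‖u x - u y‖ ^ p / ‖x - y‖ ^ q) ∂μ
      = ∫⁻ h, ‖u (y + h) - u y‖ₑ ^ p * ENNReal.ofReal (‖h‖ ^ q)⁻¹ ∂μ := by
    rw [← lintegral_add_left_eq_self _ y]
    refine lintegral_congr fun h => ?_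
    rw [add_sub_cancel_left, div_eq_mul_inv, ENNReal.ofReal_mul (by positivity),
      ← ENNReal.ofReal_rpow_of_nonneg (norm_nonneg _) hp, ofReal_norm]
  simp_rw [h1]
  rw [lintegral_lintegral_swap]
  · refine lintegral_congr fun h => ?_
    rw [lintegral_mul_const' _ _ ENNReal.ofReal_ne_top]
    rfl
  · exact ((hmeas.comp measurable_swap).mul (hw.comp measurable_snd)).aemeasurable

end LayerCake

/-! ### The weak-type constant -/

section WeakTypeConst

open Module

variable {E : Type*} [NormedAddCommGroup E] [NormedSpace ℝ E] [FiniteDimensional ℝ E]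
  [MeasurableSpace E]

/-- The constant in the weak-type estimate for the distribution of `‖u‖ ^ p`. -/
noncomputable def weakTypeConst (μ : Measure E) (p : ℝ) : ℝ :=
  4 ^ p * p / (finrank ℝ E * μ.real (Metric.ball 0 1)) *
    max 1 (2 ^ p / μ.real (Metric.ball 0 1))

theorem weakTypeConst_pos [Nontrivial E] {μ : Measure E} [μ.IsAddHaarMeasure]
    {p : ℝ} (hp : 0 < p) : 0 < weakTypeConst μ p := by
  have hW : 0 < μ.real (Metric.ball 0 1) :=
    ENNReal.toReal_pos (Metric.measure_ball_pos μ 0 one_pos).ne' measure_ball_lt_top.ne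
  have hd : 0 < (finrank ℝ E : ℝ) := by exact_mod_cast finrank_pos
  unfold weakTypeConst
  positivity

end WeakTypeConst

/-! ### The weak-type estimate -/

section WeakType

open Set Module

variable {E F : Type*} [NormedAddCommGroup E] [NormedSpace ℝ E] [FiniteDimensional ℝ E]
  [MeasurableSpace E] [BorelSpace E] [NormedAddCommGroup F] {μ : Measure E} [μ.IsAddHaarMeasure]

theorem setLIntegral_ball_mul {c : ℝ} (hc : 0 < c) (t : ℝ) {g : E → ℝ≥0∞} (hg : Measurable g) :
    ∫⁻ h in Metric.ball 0 (c * t), g h ∂μ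
      = ENNReal.ofReal (c ^ finrank ℝ E) * ∫⁻ h in Metric.ball 0 t, g (c • h) ∂μ := by
  have hcd : 0 < c ^ finrank ℝ E := pow_pos hc _
  have hG : Measurable ((Metric.ball (0 : E) (c * t)).indicator g) :=
    hg.indicator measurableSet_ball
  have h1 : ∫⁻ h in Metric.ball 0 t, g (c • h) ∂μ
      = ∫⁻ h, (Metric.ball (0 : E) (c * t)).indicator g (c • h) ∂μ := by
    rw [← lintegral_indicator measurableSet_ball]
    refine lintegral_congr fun h => ?_
    simp [indicator, norm_smul, abs_of_pos hc, hc]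
  rw [h1, ← lintegral_map hG (measurable_const_smul c), Measure.map_addHaar_smul μ hc.ne',
    lintegral_smul_measure, lintegral_indicator measurableSet_ball, abs_of_pos (inv_pos.2 hcd),
    smul_eq_mul, ← mul_assoc, ← ENNReal.ofReal_mul hcd.le, mul_inv_cancel₀ hcd.ne']
  simp

/-- For `t ≥ R` this is the absorption estimate. For `t < R` that estimate is applied on the ball of
radius `n t ≥ R` and pulled back by the dilation `h ↦ n h`: the Jacobian `n^d` cancels against the
volume, and only `n^p` is lost. -/
theorem setLIntegral_mul_measure_ball_mul_le {u : E → F} (hu : StronglyMeasurable u) {p : ℝ}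
    (hp : 1 ≤ p) {τ : ℝ≥0∞} {R t : ℝ} (hR : 0 < R) (ht : 0 < t)
    (hτ : 2 ^ p ≤ τ * μ (Metric.ball 0 R)) :
    μ (Metric.ball 0 t) *
        (∫⁻ x in {x | τ * ∫⁻ y, ‖u y‖ₑ ^ p ∂μ < ‖u x‖ₑ ^ p}, ‖u x‖ₑ ^ p ∂μ) *
        ENNReal.ofReal (min 1 (t / R) ^ p)
      ≤ 4 ^ p * ∫⁻ h in Metric.ball 0 t, translationEnergy μ p u h ∂μ := by
  have hp0 : 0 < p := zero_lt_one.trans_le hp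
  have hlarge {r : ℝ} (hr : R ≤ r) :=
    measure_ball_mul_setLIntegral_le (μ := μ) hu hp (r := r) measure_ball_lt_top.ne
      (hτ.trans (by gcongr))
  set M := ∫⁻ x in {x | τ * ∫⁻ y, ‖u y‖ₑ ^ p ∂μ < ‖u x‖ₑ ^ p}, ‖u x‖ₑ ^ p ∂μ
  have hI := measurable_translationEnergy (μ := μ) hu p
  rcases le_or_gt R t with hRt | htR
  · rw [min_eq_left ((one_le_div hR).2 hRt), Real.one_rpow, ENNReal.ofReal_one, mul_one]
    refine (hlarge hRt).trans ?_
    gcongr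
    norm_num
  · rw [min_eq_right ((div_le_one hR).2 htR.le)]
    -- Rounding up reaches radius `R`, while `R / t > 1` keeps `n ≤ 2 R / t`; this turns `2^p` into
    -- `4^p`.
    set n : ℕ := ⌈R / t⌉₊
    have h1n : R / t ≤ n := Nat.le_ceil _
    have hn0 : 0 < (n : ℝ) := (div_pos hR ht).trans_le h1n
    have hn2 : (n : ℝ) * (t / R) ≤ 2 := by
      have h1 : (n : ℝ) < R / t + 1 := Nat.ceil_lt_add_one (div_pos hR ht).le
      have h2 : (1 : ℝ) < R / t := (one_lt_div ht).2 htR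
      calc (n : ℝ) * (t / R) ≤ (R / t + R / t) * (t / R) := by gcongr; linarith
        _ = 2 := by field_simp; norm_num
    have hsmall : ∫⁻ h in Metric.ball 0 ((n : ℝ) * t), translationEnergy μ p u h ∂μ
        ≤ ENNReal.ofReal ((n : ℝ) ^ finrank ℝ E) *
          ((n : ℝ≥0∞) ^ p * ∫⁻ h in Metric.ball 0 t, translationEnergy μ p u h ∂μ) := by
      rw [setLIntegral_ball_mul hn0 t hI, ← lintegral_const_mul _ hI]
      gcongr with h
      rw [Nat.cast_smul_eq_nsmul]
      exact translationEnergy_nsmul_le hu hp n h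
    have hball := hlarge ((div_le_iff₀ ht).1 h1n)
    rw [Measure.addHaar_ball_mul_of_pos μ 0 hn0 t] at hball
    have hnd : ENNReal.ofReal ((n : ℝ) ^ finrank ℝ E) ≠ 0 := by
      simpa only [ne_eq, ENNReal.ofReal_eq_zero, not_le] using pow_pos hn0 _
    have hcancel : μ (Metric.ball 0 t) * M
        ≤ 2 ^ p * ((n : ℝ≥0∞) ^ p *
          ∫⁻ h in Metric.ball 0 t, translationEnergy μ p u h ∂μ) := by
      refine (ENNReal.mul_le_mul_iff_right hnd ENNReal.ofReal_ne_top).1 ?_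
      calc _ = ENNReal.ofReal ((n : ℝ) ^ finrank ℝ E) * μ (Metric.ball 0 t) * M := by ring
        _ ≤ _ := hball
        _ ≤ _ := mul_le_mul_right hsmall _
        _ = _ := by ring
    have hconst : (2 : ℝ≥0∞) ^ p * ((n : ℝ≥0∞) ^ p * ENNReal.ofReal ((t / R) ^ p)) ≤ 4 ^ p := by
      have h4 : (4 : ℝ≥0∞) = 2 * 2 := by norm_num
      rw [h4, ENNReal.mul_rpow_of_nonneg _ _ hp0.le,
        ← ENNReal.ofReal_rpow_of_nonneg (div_pos ht hR).le hp0.le,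
        ← ENNReal.mul_rpow_of_nonneg _ _ hp0.le]
      gcongr
      rw [← ENNReal.ofReal_natCast, ← ENNReal.ofReal_mul hn0.le]
      simpa using ENNReal.ofReal_le_ofReal hn2
    calc _ ≤ 2 ^ p * ((n : ℝ≥0∞) ^ p *
          ∫⁻ h in Metric.ball 0 t, translationEnergy μ p u h ∂μ) *
            ENNReal.ofReal ((t / R) ^ p) := by gcongr
      _ = 2 ^ p * ((n : ℝ≥0∞) ^ p * ENNReal.ofReal ((t / R) ^ p)) *
          ∫⁻ h in Metric.ball 0 t, translationEnergy μ p u h ∂μ := by ring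
      _ ≤ _ := by gcongr

/-- The bounds on the balls of radius `t`, for all `t > 0`, are integrated against `t^(-q - 1)` with
`q = d + s p`. -/
theorem setLIntegral_mul_le_lintegral_translationEnergy {u : E → F} (hu : StronglyMeasurable u)
    {p s : ℝ} (hp : 1 ≤ p) (hs0 : 0 < s) (hs1 : s < 1) {τ : ℝ≥0∞} {R : ℝ} (hR : 0 < R)
    (hτ : 2 ^ p ≤ τ * μ (Metric.ball 0 R)) :
    ENNReal.ofReal ((finrank ℝ E + s * p) * (R ^ (-(s * p)) / (s * (1 - s) * p))) *
        (μ (Metric.ball 0 1) *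
          ∫⁻ x in {x | τ * ∫⁻ y, ‖u y‖ₑ ^ p ∂μ < ‖u x‖ₑ ^ p}, ‖u x‖ₑ ^ p ∂μ)
      ≤ 4 ^ p * ∫⁻ h, translationEnergy μ p u h *
          ENNReal.ofReal (‖h‖ ^ (finrank ℝ E + s * p))⁻¹ ∂μ := by
  have hp0 : 0 < p := zero_lt_one.trans_le hp
  have hsp : 0 < s * p := mul_pos hs0 hp0
  have hsp' : 0 < p - s * p := by nlinarith
  set d := finrank ℝ E
  set q : ℝ := d + s * p with hq
  have hq0 : 0 < q := by positivity
  set M := ∫⁻ x in {x | τ * ∫⁻ y, ‖u y‖ₑ ^ p ∂μ < ‖u x‖ₑ ^ p}, ‖u x‖ₑ ^ p ∂μ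
  set W := μ (Metric.ball (0 : E) 1)
  have hzero : translationEnergy μ p u 0 = 0 := by simp [translationEnergy, hp0]
  have hpt {t : ℝ} (ht : 0 < t) :
      ENNReal.ofReal (t ^ (-(s * p) - 1) * min 1 (t / R) ^ p) * (W * M)
        ≤ 4 ^ p * (ENNReal.ofReal (t ^ (-q - 1)) *
          ∫⁻ h in Metric.ball 0 t, translationEnergy μ p u h ∂μ) := by
    have h1 := setLIntegral_mul_measure_ball_mul_le (μ := μ) hu hp hR ht hτ
    rw [Measure.addHaar_ball_of_pos μ 0 ht] at h1
    have h2 : t ^ (-(s * p) - 1) = t ^ (-q - 1) * t ^ d := by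
      rw [← Real.rpow_natCast t d, ← Real.rpow_add ht]
      congr 1
      rw [hq]
      ring
    rw [h2, ENNReal.ofReal_mul (by positivity), ENNReal.ofReal_mul (by positivity)]
    calc _ = ENNReal.ofReal (t ^ (-q - 1)) *
          (ENNReal.ofReal (t ^ d) * W * M * ENNReal.ofReal (min 1 (t / R) ^ p)) := by ring
      _ ≤ ENNReal.ofReal (t ^ (-q - 1)) *
          (4 ^ p * ∫⁻ h in Metric.ball 0 t, translationEnergy μ p u h ∂μ) := by gcongr
      _ = _ := by ring
  -- The range `t ≤ R` gives `R^(-s p) / (p - s p)` and `t > R` gives `R^(-s p) / (s p)`.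
  have hint : ENNReal.ofReal (R ^ (-(s * p)) / (s * (1 - s) * p))
      = ∫⁻ t in Ioi (0 : ℝ), ENNReal.ofReal (t ^ (-(s * p) - 1) * min 1 (t / R) ^ p) := by
    rw [← Ioc_union_Ioi_eq_Ioi hR.le, lintegral_union measurableSet_Ioi
      (Ioc_disjoint_Ioi le_rfl)]
    have hA : ∫⁻ t in Ioc 0 R, ENNReal.ofReal (t ^ (-(s * p) - 1) * min 1 (t / R) ^ p)
        = ENNReal.ofReal (R ^ (-(s * p)) / (p - s * p)) := by
      have h1 : ∫⁻ t in Ioc 0 R, ENNReal.ofReal (t ^ (-(s * p) - 1) * min 1 (t / R) ^ p)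
          = ∫⁻ t in Ioc 0 R, ENNReal.ofReal (t ^ (p - s * p - 1)) *
            ENNReal.ofReal (R ^ (-p)) := by
        refine setLIntegral_congr_fun measurableSet_Ioc fun t ht => ?_
        rw [min_eq_right ((div_le_one hR).2 ht.2), ← ENNReal.ofReal_mul
          (Real.rpow_nonneg ht.1.le _), Real.div_rpow ht.1.le hR.le, Real.rpow_neg hR.le,
          ← div_eq_mul_inv, ← mul_div_assoc, ← Real.rpow_add ht.1]
        congr 3
        ring
      rw [h1, lintegral_mul_const' _ _ ENNReal.ofReal_ne_top, lintegral_Ioc_zero_rpow hR hsp',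
        ← ENNReal.ofReal_mul (by positivity), div_mul_eq_mul_div, ← Real.rpow_add hR]
      congr 4
      ring
    have hB : ∫⁻ t in Ioi R, ENNReal.ofReal (t ^ (-(s * p) - 1) * min 1 (t / R) ^ p)
        = ENNReal.ofReal (R ^ (-(s * p)) / (s * p)) := by
      rw [← lintegral_Ioi_rpow_neg hR hsp]
      refine setLIntegral_congr_fun measurableSet_Ioi fun t ht => ?_
      rw [min_eq_left ((one_le_div hR).2 (le_of_lt ht)), Real.one_rpow, mul_one]
    rw [hA, hB, ← ENNReal.ofReal_add (by positivity) (by positivity)]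
    congr 1
    have h1s : 1 - s ≠ 0 := by linarith
    have : p - s * p = (1 - s) * p := by ring
    rw [this]
    field_simp
    ring
  rw [← lintegral_Ioi_mul_setLIntegral_ball (measurable_translationEnergy hu p) hzero hq0,
    ENNReal.ofReal_mul hq0.le, mul_assoc, mul_left_comm (4 ^ p)]
  refine mul_le_mul_right ?_ _
  rw [hint, ← lintegral_mul_const _ (by fun_prop), ← lintegral_const_mul' (4 ^ p) _ (by simp)]
  exact setLIntegral_mono' measurableSet_Ioi fun t ht => hpt ht

/-- Weak-type form of the fractional Sobolev inequality, with the sharp order of the constant as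
`s → 0` and as `s → 1`. -/
theorem setLIntegral_lt_enorm_rpow_le [Nontrivial E] {u : E → F} (hu : StronglyMeasurable u)
    {p s : ℝ} (hp : 1 ≤ p) (hs0 : 0 < s) (hs1 : s < 1) (hspd : s * p ≤ finrank ℝ E) {τ : ℝ}
    (hτ : 0 < τ) :
    ∫⁻ x in {x | ENNReal.ofReal τ * ∫⁻ y, ‖u y‖ₑ ^ p ∂μ < ‖u x‖ₑ ^ p}, ‖u x‖ₑ ^ p ∂μ
      ≤ ENNReal.ofReal (weakTypeConst μ p * (s * (1 - s)) * τ ^ (-(s * p / finrank ℝ E))) *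
        ∫⁻ h, translationEnergy μ p u h *
          ENNReal.ofReal (‖h‖ ^ (finrank ℝ E + s * p))⁻¹ ∂μ := by
  have hp0 : 0 < p := zero_lt_one.trans_le hp
  have hsp : 0 < s * p := mul_pos hs0 hp0
  have h1s : 0 < 1 - s := by linarith
  have hW : 0 < μ.real (Metric.ball (0 : E) 1) :=
    ENNReal.toReal_pos (Metric.measure_ball_pos μ 0 one_pos).ne' measure_ball_lt_top.ne
  have hd : 0 < (finrank ℝ E : ℝ) := by exact_mod_cast finrank_pos
  have hWeq : μ (Metric.ball (0 : E) 1) = ENNReal.ofReal (μ.real (Metric.ball (0 : E) 1)) :=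
    (ofReal_measureReal measure_ball_lt_top.ne).symm
  unfold weakTypeConst
  set W := μ.real (Metric.ball (0 : E) 1)
  set d := finrank ℝ E
  set Q := 2 ^ p / W with hQ
  have hQ0 : 0 < Q := by positivity
  -- The radius at which `τ μ(B_R) = 2^p` exactly.
  set R := (Q / τ) ^ (1 / (d : ℝ)) with hRdef
  have hR : 0 < R := by positivity
  have hRd : R ^ d = Q / τ := by
    rw [hRdef, ← Real.rpow_natCast, ← Real.rpow_mul (by positivity), one_div,
      inv_mul_cancel₀ hd.ne', Real.rpow_one]
  have hcond : 2 ^ p ≤ ENNReal.ofReal τ * μ (Metric.ball (0 : E) R) := by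
    rw [Measure.addHaar_ball_of_pos μ 0 hR, hWeq, ← ENNReal.ofReal_mul (by positivity),
      ← ENNReal.ofReal_mul hτ.le]
    change _ ≤ ENNReal.ofReal (τ * (R ^ d * W))
    rw [hRd, hQ]
    have : τ * (2 ^ p / W / τ * W) = (2 : ℝ) ^ p := by field_simp
    rw [this, ← ENNReal.ofReal_rpow_of_pos two_pos]
    simp
  have hmain := setLIntegral_mul_le_lintegral_translationEnergy (μ := μ) hu hp hs0 hs1 hR hcond
  set G := ∫⁻ h, translationEnergy μ p u h * ENNReal.ofReal (‖h‖ ^ (d + s * p))⁻¹ ∂μ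
  set M := ∫⁻ x in {x | ENNReal.ofReal τ * ∫⁻ y, ‖u y‖ₑ ^ p ∂μ < ‖u x‖ₑ ^ p}, ‖u x‖ₑ ^ p ∂μ
  rw [hWeq, ← mul_assoc, ← ENNReal.ofReal_mul (by positivity)] at hmain
  change ENNReal.ofReal ((d + s * p) * (R ^ (-(s * p)) / (s * (1 - s) * p)) * W) * M ≤ _ at hmain
  set κ := (d + s * p) * (R ^ (-(s * p)) / (s * (1 - s) * p)) * W with hκ
  have hκ0 : 0 < κ := by positivity
  -- The dependence on `s` is removed by `d + s p ≥ d` and by `Q^(s p / d) ≤ max 1 Q`, whose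
  -- exponent lies in `[0, 1]`.
  have hκK : 4 ^ p / κ ≤
      4 ^ p * p / (d * W) * max 1 Q * (s * (1 - s)) * τ ^ (-(s * p / (d : ℝ))) := by
    have hb0 : 0 ≤ s * p / (d : ℝ) := by positivity
    have hb1 : s * p / (d : ℝ) ≤ 1 := (div_le_one hd).2 hspd
    have hRsp : R ^ (s * p) = Q ^ (s * p / (d : ℝ)) * τ ^ (-(s * p / (d : ℝ))) := by
      rw [hRdef, ← Real.rpow_mul (by positivity), one_div_mul_eq_div,
        Real.div_rpow hQ0.le hτ.le, Real.rpow_neg hτ.le, div_eq_mul_inv]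
    have hQb : Q ^ (s * p / (d : ℝ)) ≤ max 1 Q := by
      rcases le_total Q 1 with h | h
      · exact (Real.rpow_le_one hQ0.le h hb0).trans (le_max_left _ _)
      · refine (Real.rpow_le_rpow_of_exponent_le h hb1).trans ?_
        rw [Real.rpow_one]
        exact le_max_right _ _
    calc (4 : ℝ) ^ p / κ = 4 ^ p * p / ((d + s * p) * W) * R ^ (s * p) * (s * (1 - s)) := by
          rw [hκ, Real.rpow_neg hR.le]
          field_simp
      _ ≤ 4 ^ p * p / (d * W) * (max 1 Q * τ ^ (-(s * p / (d : ℝ)))) * (s * (1 - s)) := by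
          rw [hRsp]
          gcongr
          linarith
      _ = _ := by ring
  calc M = ENNReal.ofReal κ⁻¹ * (ENNReal.ofReal κ * M) := by
        rw [← mul_assoc, ← ENNReal.ofReal_mul (by positivity), inv_mul_cancel₀ hκ0.ne']
        simp
    _ ≤ ENNReal.ofReal κ⁻¹ * (ENNReal.ofReal (4 ^ p) * G) := by
        refine mul_le_mul_right (hmain.trans_eq ?_) _
        rw [← ENNReal.ofReal_rpow_of_pos four_pos]
        simp
    _ = ENNReal.ofReal (4 ^ p / κ) * G := by
        rw [← mul_assoc, ← ENNReal.ofReal_mul (by positivity), inv_mul_eq_div]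
    _ ≤ _ := mul_le_mul_left (ENNReal.ofReal_le_ofReal hκK) _

end WeakType

/-! ### From the weak-type bound to the logarithm -/

section LogLayerCake

open Set

theorem lintegral_Ioo_inv {a b : ℝ} (ha : 0 < a) (hb : 0 ≤ b) :
    ∫⁻ t in Ioo a b, ENNReal.ofReal t⁻¹ = ENNReal.ofReal (Real.log (b / a)) := by
  -- For `b ≤ a` both sides vanish: `ENNReal.ofReal` discards a negative logarithm, and `Real.log 0
  -- = 0` covers `b = 0`.
  rcases le_or_gt b a with hba | hab
  · rw [Ioo_eq_empty (not_lt.2 hba), Measure.restrict_empty, lintegral_zero_measure,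
      ENNReal.ofReal_of_nonpos]
    exact Real.log_nonpos (by positivity) ((div_le_one ha).2 hba)
  · have h0 : (0 : ℝ) ∉ uIcc a b := by
      rw [uIcc_of_le hab.le]
      exact fun h => ha.not_ge h.1
    have hint : IntervalIntegrable (fun t : ℝ => t⁻¹) volume a b :=
      intervalIntegral.intervalIntegrable_inv (fun t ht h => h0 (h ▸ ht)) continuousOn_id
    rw [setLIntegral_congr (Ioo_ae_eq_Ioc (μ := volume) (a := a) (b := b)),
      ← ofReal_integral_eq_lintegral_ofReal
        ((intervalIntegrable_iff_integrableOn_Ioc_of_le hab.le).1 hint),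
      ← intervalIntegral.integral_of_le hab.le, integral_inv h0]
    exact (ae_restrict_mem measurableSet_Ioc).mono fun t ht => inv_nonneg.2 (ha.trans ht.1).le

variable {α : Type*} [MeasurableSpace α] {μ : Measure α} [SFinite μ]

/-- Tonelli, since the positive part of `log (y / a)` is `∫ dt / t` over `a < t < y`, here with `y =
f x / N`. -/
theorem lintegral_mul_log_eq {f : α → ℝ} (hf : Measurable f) (hf0 : ∀ x, 0 ≤ f x) {N a : ℝ}
    (hN : 0 < N) (ha : 0 < a) :
    ∫⁻ x, ENNReal.ofReal (f x * Real.log (f x / N / a)) ∂μ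
      = ∫⁻ t in Ioi a, ENNReal.ofReal t⁻¹ * ∫⁻ x in {x | t * N < f x}, ENNReal.ofReal (f x) ∂μ := by
  have hset : MeasurableSet {z : ℝ × α | z.1 * N < f z.2} :=
    measurableSet_lt (measurable_fst.mul_const N) (hf.comp measurable_snd)
  have hk : Measurable fun z : ℝ × α => ENNReal.ofReal z.1⁻¹ *
      {z : ℝ × α | z.1 * N < f z.2}.indicator (fun z => ENNReal.ofReal (f z.2)) z :=
    (measurable_fst.inv.ennreal_ofReal).mul ((hf.comp measurable_snd).ennreal_ofReal.indicator hset)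
  have hinner (t : ℝ) :
      ENNReal.ofReal t⁻¹ * ∫⁻ x in {x | t * N < f x}, ENNReal.ofReal (f x) ∂μ
        = ∫⁻ x, ENNReal.ofReal t⁻¹ *
          {z : ℝ × α | z.1 * N < f z.2}.indicator (fun z => ENNReal.ofReal (f z.2)) (t, x) ∂μ := by
    rw [lintegral_const_mul' _ _ ENNReal.ofReal_ne_top,
      ← lintegral_indicator (measurableSet_lt measurable_const hf)]
    simp [indicator]
  simp_rw [hinner]
  rw [lintegral_lintegral_swap hk.aemeasurable]
  refine lintegral_congr fun x => ?_
  have h1 : ∫⁻ t in Ioi a, ENNReal.ofReal t⁻¹ *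
        {z : ℝ × α | z.1 * N < f z.2}.indicator (fun z => ENNReal.ofReal (f z.2)) (t, x)
      = ∫⁻ t in Ioo a (f x / N), ENNReal.ofReal t⁻¹ * ENNReal.ofReal (f x) := by
    rw [← lintegral_indicator measurableSet_Ioi, ← lintegral_indicator measurableSet_Ioo]
    refine lintegral_congr fun t => ?_
    by_cases hat : a < t <;> by_cases htf : t * N < f x <;>
      simp [indicator, hat, htf, lt_div_iff₀ hN]
  rw [h1, lintegral_mul_const' _ _ ENNReal.ofReal_ne_top,
    lintegral_Ioo_inv ha (div_nonneg (hf0 x) hN.le), mul_comm (f x), ENNReal.ofReal_mul' (hf0 x)]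

theorem lintegral_mul_log_le_of_weakType {f : α → ℝ} (hf : Measurable f) (hf0 : ∀ x, 0 ≤ f x)
    {N a A b : ℝ} (hN : 0 < N) (ha : 0 < a) (hb : 0 < b) (hA : 0 ≤ A)
    (hweak : ∀ t, 0 < t →
      ∫⁻ x in {x | t * N < f x}, ENNReal.ofReal (f x) ∂μ ≤ ENNReal.ofReal (A * t ^ (-b))) :
    ∫⁻ x, ENNReal.ofReal (f x * Real.log (f x / N / a)) ∂μ
      ≤ ENNReal.ofReal (A * (a ^ (-b) / b)) := by
  rw [lintegral_mul_log_eq hf hf0 hN ha, ENNReal.ofReal_mul hA, ← lintegral_Ioi_rpow_neg ha hb,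
    ← lintegral_const_mul' _ _ ENNReal.ofReal_ne_top]
  refine setLIntegral_mono' measurableSet_Ioi fun t ht => ?_
  have ht0 : 0 < t := ha.trans ht
  calc _ ≤ ENNReal.ofReal t⁻¹ * ENNReal.ofReal (A * t ^ (-b)) := by
        gcongr
        exact hweak t ht0
    _ = _ := by
        rw [← ENNReal.ofReal_mul (by positivity), ← ENNReal.ofReal_mul hA, Real.rpow_sub_one ht0.ne']
        congr 1
        ring

end LogLayerCake

/-! ### Integrals with values in `[-∞, ∞)` -/

section ExtIntegral

variable {d : ℕ}

theorem extIntegral_congr_ae {f g : EuclideanSpace ℝ (Fin d) → ℝ} (h : f =ᵐ[volume] g) :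
    extIntegral f = extIntegral g := by
  unfold extIntegral
  congr 2 <;> exact lintegral_congr_ae (h.mono fun x hx => by simp only [hx])

theorem extIntegral_zero : extIntegral (0 : EuclideanSpace ℝ (Fin d) → ℝ) = 0 := by
  simp [extIntegral]

theorem extIntegral_of_integrable {f : EuclideanSpace ℝ (Fin d) → ℝ} (hf : Integrable f) :
    extIntegral f = ((∫ x, f x : ℝ) : EReal) := by
  have hpos : ∫⁻ x, ENNReal.ofReal (f x) ≠ ⊤ := hf.lintegral_lt_top.ne
  have hneg : ∫⁻ x, ENNReal.ofReal (-f x) ≠ ⊤ := hf.neg.lintegral_lt_top.ne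
  rw [extIntegral, integral_eq_lintegral_pos_part_sub_lintegral_neg_part hf, EReal.coe_sub,
    EReal.coe_ennreal_toReal hpos, EReal.coe_ennreal_toReal hneg]

/-- Either the negative part of `f` has infinite integral and the left side is `⊥`, or `f`, and with
it `h = f - g`, is integrable and the negative part of `h` can be dropped. -/
theorem extIntegral_le_of_le_add {f g h : EuclideanSpace ℝ (Fin d) → ℝ}
    (hf : AEStronglyMeasurable f) (hpos : ∫⁻ x, ENNReal.ofReal (f x) < ⊤) (hg : Integrable g)
    (hfgh : ∀ x, f x = g x + h x) {K : ℝ} (hK : 0 ≤ K)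
    (hh : ∫⁻ x, ENNReal.ofReal (h x) ≤ ENNReal.ofReal K) :
    extIntegral f ≤ ((∫ x, g x) + K : ℝ) := by
  by_cases hneg : ∫⁻ x, ENNReal.ofReal (-f x) = ⊤
  · simp [extIntegral, hneg]
  have hfi : Integrable f := by
    refine ⟨hf, ?_⟩
    rw [hasFiniteIntegral_iff_norm]
    calc ∫⁻ x, ENNReal.ofReal ‖f x‖
        ≤ ∫⁻ x, (ENNReal.ofReal (f x) + ENNReal.ofReal (-f x)) := by
          refine lintegral_mono fun x => ?_
          rcases le_total 0 (f x) with hx | hx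
          · simp [abs_of_nonneg hx]
          · simp [abs_of_nonpos hx]
      _ = (∫⁻ x, ENNReal.ofReal (f x)) + ∫⁻ x, ENNReal.ofReal (-f x) :=
          lintegral_add_left' hf.aemeasurable.ennreal_ofReal _
      _ < ⊤ := ENNReal.add_lt_top.2 ⟨hpos, Ne.lt_top hneg⟩
  have hhi : Integrable h := (hfi.sub hg).congr (.of_forall fun x => by simp [hfgh])
  rw [extIntegral_of_integrable hfi, EReal.coe_le_coe_iff, integral_congr_ae (.of_forall hfgh),
    integral_add hg hhi]
  gcongr
  rw [integral_eq_lintegral_pos_part_sub_lintegral_neg_part hhi]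
  exact (sub_le_self _ ENNReal.toReal_nonneg).trans
    (ENNReal.toReal_le_of_le_ofReal hK hh)

end ExtIntegral

/-! ### The entropy inequality with the bounded constant -/

section FracSobolev

open Module

variable {d : ℕ} {𝕜 : Type*} [RCLike 𝕜]

theorem gagliardoEnergy_congr_ae {u v : EuclideanSpace ℝ (Fin d) → 𝕜} (h : u =ᵐ[volume] v)
    (s p : ℝ) : gagliardoEnergy s p u = gagliardoEnergy s p v :=
  lintegral_congr_ae <| h.mono fun y hy => lintegral_congr_ae <| h.mono fun x hx => by
    simp only [hx, hy]

theorem entropyIntegrand_congr_ae {u v : EuclideanSpace ℝ (Fin d) → 𝕜} (h : u =ᵐ[volume] v)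
    (p : ℝ) : entropyIntegrand p u =ᵐ[volume] entropyIntegrand p v := by
  have hN : ∫ y, ‖u y‖ ^ p = ∫ y, ‖v y‖ ^ p :=
    integral_congr_ae (h.mono fun y hy => by simp only [hy])
  filter_upwards [h] with x hx
  simp only [entropyIntegrand, hN, hx]

theorem entropyIntegrand_eq_zero {p : ℝ} {u : EuclideanSpace ℝ (Fin d) → 𝕜}
    (h : ∫ y, ‖u y‖ ^ p = 0) : entropyIntegrand p u = 0 := by
  ext x
  simp [entropyIntegrand, h]

theorem gagliardoEnergy_eq_lintegral_translationEnergy {s p : ℝ} (hp : 0 ≤ p)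
    {u : EuclideanSpace ℝ (Fin d) → 𝕜} (hu : StronglyMeasurable u) :
    gagliardoEnergy s p u
      = ∫⁻ h, translationEnergy volume p u h * ENNReal.ofReal (‖h‖ ^ ((d : ℝ) + s * p))⁻¹ :=
  lintegral_lintegral_sub_eq hu hp _

theorem setLIntegral_lt_norm_rpow_le_gagliardoEnergy (hd : 0 < d) {s p : ℝ} (hp : 1 ≤ p)
    (hs0 : 0 < s) (hs1 : s < 1) (hspd : s * p ≤ d) {u : EuclideanSpace ℝ (Fin d) → 𝕜}
    (hu : StronglyMeasurable u) (hN : Integrable fun x => ‖u x‖ ^ p)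
    (hE : gagliardoEnergy s p u ≠ ⊤) {t : ℝ} (ht : 0 < t) :
    ∫⁻ x in {x | t * ∫ y, ‖u y‖ ^ p < ‖u x‖ ^ p}, ENNReal.ofReal (‖u x‖ ^ p)
      ≤ ENNReal.ofReal (weakTypeConst (volume : Measure (EuclideanSpace ℝ (Fin d))) p *
        (s * (1 - s)) * (gagliardoEnergy s p u).toReal * t ^ (-(s * p / d))) := by
  have hp0 : 0 ≤ p := zero_le_one.trans hp
  have : Nonempty (Fin d) := ⟨⟨0, hd⟩⟩
  have henorm (x : EuclideanSpace ℝ (Fin d)) : ‖u x‖ₑ ^ p = ENNReal.ofReal (‖u x‖ ^ p) := by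
    rw [← ENNReal.ofReal_rpow_of_nonneg (norm_nonneg _) hp0, ofReal_norm]
  have hNeq : ∫⁻ y, ENNReal.ofReal (‖u y‖ ^ p) = ENNReal.ofReal (∫ y, ‖u y‖ ^ p) :=
    (ofReal_integral_eq_lintegral_ofReal hN (.of_forall fun x => by positivity)).symm
  have hset : {x | ENNReal.ofReal t * ENNReal.ofReal (∫ y, ‖u y‖ ^ p) < ENNReal.ofReal (‖u x‖ ^ p)}
      = {x | t * ∫ y, ‖u y‖ ^ p < ‖u x‖ ^ p} := by
    ext x
    rw [Set.mem_ofPred_eq, Set.mem_ofPred_eq, ← ENNReal.ofReal_mul ht.le]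
    exact ENNReal.ofReal_lt_ofReal_iff_of_nonneg
      (mul_nonneg ht.le (integral_nonneg fun x => by positivity))
  have h := setLIntegral_lt_enorm_rpow_le (μ := (volume : Measure (EuclideanSpace ℝ (Fin d)))) hu hp
    hs0 hs1 (by simpa using hspd) ht
  simp only [henorm, finrank_euclideanSpace_fin, hNeq, hset] at h
  refine h.trans_eq ?_
  rw [← gagliardoEnergy_eq_lintegral_translationEnergy hp0 hu,
    mul_right_comm _ (gagliardoEnergy s p u).toReal,
    ENNReal.ofReal_mul' ENNReal.toReal_nonneg, ENNReal.ofReal_toReal hE]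

/-- The logarithmic Sobolev inequality for a strongly measurable function, with a constant that
stays bounded as `s p → d`. -/
theorem extIntegral_entropyIntegrand_le (hd : 0 < d) {s p : ℝ} (hp : 1 ≤ p) (hs0 : 0 < s)
    (hs1 : s < 1) (hspd : s * p ≤ d) {u : EuclideanSpace ℝ (Fin d) → 𝕜} (hu : StronglyMeasurable u)
    (hI : Integrable fun x => ‖u x‖ ^ p) (hE : gagliardoEnergy s p u ≠ ⊤) :
    (∫⁻ x, ENNReal.ofReal (entropyIntegrand p u x)) < ⊤ ∧
      ∀ c : ℝ, 0 < c →
        extIntegral (entropyIntegrand p u)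
          ≤ ((-((d / s) * (1 + Real.log c) * ∫ x, ‖u x‖ ^ p) +
              weakTypeConst (volume : Measure (EuclideanSpace ℝ (Fin d))) p * (s * (1 - s)) *
                (gagliardoEnergy s p u).toReal *
                ((Real.exp 1 * c) ^ p / (s * p / d)) : ℝ) : EReal) := by
  have hp0 : 0 < p := zero_lt_one.trans_le hp
  have hd0 : (0 : ℝ) < d := by exact_mod_cast hd
  have h1s : 0 < 1 - s := by linarith
  have : Nonempty (Fin d) := ⟨⟨0, hd⟩⟩
  have hK := weakTypeConst_pos (μ := (volume : Measure (EuclideanSpace ℝ (Fin d)))) hp0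
  set K := weakTypeConst (volume : Measure (EuclideanSpace ℝ (Fin d))) p
  set A := K * (s * (1 - s)) * (gagliardoEnergy s p u).toReal
  have hA : 0 ≤ A := by positivity
  set b := s * p / d with hbdef
  have hb : 0 < b := by positivity
  have hf : Measurable fun x => ‖u x‖ ^ p := hu.norm.measurable.pow_const p
  have hf0 (x : EuclideanSpace ℝ (Fin d)) : 0 ≤ ‖u x‖ ^ p := by positivity
  -- If `N = 0`, division by zero and `Real.log 0 = 0` make the integrand vanish identically.
  rcases (integral_nonneg hf0 : 0 ≤ ∫ x, ‖u x‖ ^ p).eq_or_lt with hN | hN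
  · rw [entropyIntegrand_eq_zero hN.symm, ← hN, extIntegral_zero]
    refine ⟨by simp, fun c hc => ?_⟩
    rw [mul_zero, neg_zero, zero_add]
    exact_mod_cast (by positivity : 0 ≤ A * ((Real.exp 1 * c) ^ p / b))
  have htail {a : ℝ} (ha : 0 < a) :=
    lintegral_mul_log_le_of_weakType hf hf0 hN ha hb hA fun t ht =>
      setLIntegral_lt_norm_rpow_le_gagliardoEnergy hd hp hs0 hs1 hspd hu hI hE ht
  have hpos : (∫⁻ x, ENNReal.ofReal (entropyIntegrand p u x)) < ⊤ := by
    -- The tail bound at `a = 1` concerns precisely the positive part of the entropy integrand.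
    have h1 := htail one_pos
    simp only [div_one] at h1
    exact h1.trans_lt ENNReal.ofReal_lt_top
  refine ⟨hpos, fun c hc => ?_⟩
  have hec : 0 < Real.exp 1 * c := by positivity
  -- Chosen so that `log a = -(d / s)(1 + log c)` produces the linear term and `a^(-b) = (e c)^p`
  -- the energy term.
  set a := (Real.exp 1 * c) ^ (-(d / s : ℝ)) with hadef
  have ha : 0 < a := by positivity
  have hloga : Real.log a = -(d / s * (1 + Real.log c)) := by
    rw [hadef, Real.log_rpow hec, Real.log_mul (Real.exp_ne_zero 1) hc.ne', Real.log_exp]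
    ring
  have hab : a ^ (-b) = (Real.exp 1 * c) ^ p := by
    rw [hadef, ← Real.rpow_mul hec.le]
    congr 1
    rw [hbdef]
    field_simp
  have hsplit (x : EuclideanSpace ℝ (Fin d)) : entropyIntegrand p u x
      = Real.log a * ‖u x‖ ^ p + ‖u x‖ ^ p * Real.log (‖u x‖ ^ p / (∫ y, ‖u y‖ ^ p) / a) := by
    rcases (hf0 x).eq_or_lt with hx | hx
    · simp [entropyIntegrand, ← hx]
    · rw [Real.log_div (div_pos hx hN).ne' ha.ne', entropyIntegrand]
      ring
  have hmeas : Measurable (entropyIntegrand p u) :=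
    hf.mul (Real.measurable_log.comp (hf.div_const _))
  refine (extIntegral_le_of_le_add hmeas.aestronglyMeasurable hpos (hI.const_mul (Real.log a))
    hsplit (by positivity) (htail ha)).trans_eq ?_
  rw [integral_const_mul, hloga, hab, neg_mul]

end FracSobolev

/-! ### The inequality with the stated constant -/

theorem theorem1p2 (d : ℕ) (p : ℝ) (hp : 1 < p) :
    ∃ C : ℝ, 0 < C ∧
      ∀ (𝕜 : Type) [RCLike 𝕜] (s : ℝ), 0 < s → s < 1 → s * p < d →
        ∀ u : EuclideanSpace ℝ (Fin d) → 𝕜, MemFracSobolev s p u →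
          (∫⁻ x, ENNReal.ofReal (entropyIntegrand p u x)) < ⊤ ∧
          ∀ c : ℝ, 0 < c →
            extIntegral (entropyIntegrand p u)
                + (((d / s) * (1 + Real.log c) * ∫ x, ‖u x‖ ^ p : ℝ) : EReal)
              ≤ ((d * Real.exp (p - 1) * c ^ p
                    * (C * (s * (1 - s) / ((d : ℝ) - s * p) ^ (p - 1))) / (s * p)
                  * (gagliardoEnergy s p u).toReal : ℝ) : EReal) := by
  rcases Nat.eq_zero_or_pos d with rfl | hd
  · refine ⟨1, one_pos, fun 𝕜 _ s hs0 _ hspd => ?_⟩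
    have : 0 < s * p := mul_pos hs0 (zero_lt_one.trans hp)
    rw [Nat.cast_zero] at hspd
    exact absurd hspd this.not_gt
  have hp0 : 0 < p := zero_lt_one.trans hp
  have hd0 : (0 : ℝ) < d := by exact_mod_cast hd
  have : Nonempty (Fin d) := ⟨⟨0, hd⟩⟩
  have hK := weakTypeConst_pos (μ := (volume : Measure (EuclideanSpace ℝ (Fin d)))) hp0
  set K := weakTypeConst (volume : Measure (EuclideanSpace ℝ (Fin d))) p
  -- The factor `e` accounts for `(e c)^p` against `e^(p - 1) c^p`; `d^(p - 1)` compensates the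
  -- division by `(d - s p)^(p - 1)`.
  refine ⟨Real.exp 1 * K * (d : ℝ) ^ (p - 1), by positivity, fun 𝕜 _ s hs0 hs1 hspd u hu => ?_⟩
  -- All quantities involved are invariant under a.e. equality, so a strongly measurable
  -- representative may be used.
  obtain ⟨v, hv, huv⟩ := hu.memLp.aestronglyMeasurable
  have hvp : Integrable fun x => ‖v x‖ ^ p := by
    have h := ((memLp_congr_ae huv).1 hu.memLp).integrable_norm_rpow
      (by simpa using hp0) ENNReal.ofReal_ne_top
    rwa [ENNReal.toReal_ofReal hp0.le] at h
  have hN : ∫ x, ‖u x‖ ^ p = ∫ x, ‖v x‖ ^ p :=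
    integral_congr_ae (huv.mono fun x hx => by simp only [hx])
  have hE := gagliardoEnergy_congr_ae huv s p
  have hent := entropyIntegrand_congr_ae huv p
  obtain ⟨hpos, hineq⟩ := extIntegral_entropyIntegrand_le hd hp.le hs0 hs1 hspd.le hv hvp
    (hE ▸ hu.energy_lt_top.ne)
  refine ⟨?_, fun c hc => ?_⟩
  · exact (lintegral_congr_ae (hent.mono fun x hx => by simp only [hx])).trans_lt hpos
  rw [extIntegral_congr_ae hent, hN, hE]
  refine (add_le_add_left (hineq c hc) _).trans ?_
  rw [← EReal.coe_add, EReal.coe_le_coe_iff, neg_add_cancel_comm]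
  have hds : 0 < (d : ℝ) - s * p := by linarith
  have h1s : 0 < 1 - s := by linarith
  have hG : 0 ≤ (gagliardoEnergy s p v).toReal := ENNReal.toReal_nonneg
  have hratio : 1 ≤ (d : ℝ) ^ (p - 1) / ((d : ℝ) - s * p) ^ (p - 1) := by
    rw [one_le_div (by positivity)]
    have : 0 < s * p := by positivity
    exact Real.rpow_le_rpow hds.le (by linarith) (by linarith)
  have hexp : (Real.exp 1 * c) ^ p = Real.exp 1 * Real.exp (p - 1) * c ^ p := by
    rw [Real.mul_rpow (Real.exp_pos 1).le hc.le, ← Real.exp_mul, one_mul, ← Real.exp_add]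
    ring_nf
  set G := (gagliardoEnergy s p v).toReal
  calc K * (s * (1 - s)) * G * ((Real.exp 1 * c) ^ p / (s * p / d))
      = d * Real.exp (p - 1) * c ^ p * (Real.exp 1 * K * (s * (1 - s))) / (s * p) * G * 1 := by
        rw [hexp]
        field_simp
    _ ≤ d * Real.exp (p - 1) * c ^ p * (Real.exp 1 * K * (s * (1 - s))) / (s * p) * G *
        ((d : ℝ) ^ (p - 1) / ((d : ℝ) - s * p) ^ (p - 1)) := by gcongr
    _ = _ := by ring
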